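/- Let $\mathbb F$ be a field of characteristic two. An $n$-dimensional nilpotent Lie algebra $\mathfrak g$ over $\mathbb F$ is called filiform if $\mathrm{ad}(x)^{n-2}\neq 0$ for some $x\in\mathfrak g$. It is said to be of Vergne type if it is filiform and has a basis $e_1,\dots,e_n$ such that $[e_1,e_i]=e_{i+1}$ for $2\le i\le n-1$, $[e_i,e_j]=c_{i,j}e_{i+j}$ with $c_{i,j}\in\mathbb F$ for all $i,j\ge 2$ with $i+j\le n$, and $[e_1,e_n]=0$ and $[e_i,e_j]=0$ for all $i,j\ge2$ with $i+j>n$. The $k$-th Betti number of $\mathfrak g$ is $b_k(\mathfrak g)=\dim_{\mathbb F} H^k(\mathfrak g,\mathbb F)$, the dimension of the Lie algebra cohomology with trivial coefficients. Theorem. For every Lie algebra $\mathfrak g$ of Vergne type over $\mathbb F$ with $\dim\mathfrak g\ge 5$ there exists a Lie algebra $\mathfrak h$ of Vergne type over $\mathbb F$ that is not isomorphic to $\mathfrak g$ and satisfies $b_k(\mathfrak h)=b_k(\mathfrak g)$ for all $k\ge 0$. -/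

import Mathlib

universe u v

/-! ## The Chevalley–Eilenberg complex with trivial coefficients -/

namespace ChevalleyEilenberg

section

variable {R : Type u} [CommRing R] {L : Type v} [LieRing L] [LieAlgebra R L]

/-- The `n`-cochains of `L` with trivial coefficients: alternating `n`-forms on `L`. -/
abbrev Cochain (R : Type u) [CommRing R] (L : Type v) [LieRing L] [LieAlgebra R L] (n : ℕ) :
    Type (max u v) :=
  L [⋀^Fin n]→ₗ[R] R

/-- The Chevalley–Eilenberg differential of a cochain, as a function:
`(dω)(v₀, …, vₙ) = ∑_{p < q} (-1) ^ (p + q) ω([v_p, v_q], v₀, …, v̂_p, …, v̂_q, …, vₙ)`.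
The pairs `p < q` are encoded as `p = i`, `q = j + 1` with `i ≤ j`. -/
def dFun : (n : ℕ) → Cochain R L n → (Fin (n + 1) → L) → R
  | 0, _, _ => 0
  | n + 1, ω, v => ∑ i : Fin (n + 1), ∑ j ∈ Finset.Ici i,
      (-1 : R) ^ ((i : ℕ) + ((j : ℕ) + 1)) *
        ω (Matrix.vecCons ⁅v i.castSucc, v j.succ⁆ (j.removeNth (i.castSucc.removeNth v)))

/-- One summand of the differential, as a multilinear map. -/
def dTerm {n : ℕ} (ω : Cochain R L (n + 1)) (i j : Fin (n + 1)) :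
    MultilinearMap R (fun _ : Fin (n + 2) => L) R :=
  LinearMap.uncurryMid i.castSucc
    { toFun := fun x => LinearMap.uncurryMid j
        ((AlternatingMap.toMultilinearMapLM (S := R)) ∘ₗ ω.curryLeft ∘ₗ
          (LieAlgebra.ad R L x : L →ₗ[R] L))
      map_add' := fun x y => by ext; simp [Matrix.vecCons]
      map_smul' := fun c x => by ext; simp }

theorem dTerm_apply {n : ℕ} (ω : Cochain R L (n + 1)) {i j : Fin (n + 1)} (hij : i ≤ j)
    (v : Fin (n + 2) → L) :
    dTerm ω i j v =
      ω (Matrix.vecCons ⁅v i.castSucc, v j.succ⁆ (j.removeNth (i.castSucc.removeNth v))) := by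
  have H : i.castSucc.removeNth v j = v j.succ := by
    simp [Fin.removeNth_apply, Fin.succAbove_of_le_castSucc, hij]
  simp [dTerm, H, Matrix.vecCons]

/-- The differential of a cochain as a multilinear map. -/
def dMulti : (n : ℕ) → Cochain R L n → MultilinearMap R (fun _ : Fin (n + 1) => L) R
  | 0, _ => 0
  | n + 1, ω => ∑ i : Fin (n + 1), ∑ j ∈ Finset.Ici i,
      (-1 : R) ^ ((i : ℕ) + ((j : ℕ) + 1)) • dTerm ω i j

theorem dMulti_apply (n : ℕ) (ω : Cochain R L n) (v : Fin (n + 1) → L) :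
    dMulti n ω v = dFun n ω v := by
  cases n with
  | zero => simp [dMulti, dFun]
  | succ n =>
    simp only [dMulti, dFun, sum_apply, smul_apply, smul_eq_mul]
    refine Finset.sum_congr rfl fun i _ => Finset.sum_congr rfl fun j hj => ?_
    rw [dTerm_apply ω (Finset.mem_Ici.1 hj)]

/-- An alternating form changes sign when its first two arguments are exchanged. -/
theorem map_cons_cons {n : ℕ} (ω : Cochain R L (n + 2)) (x y : L) (v : Fin n → L) :
    ω (Matrix.vecCons x (Matrix.vecCons y v)) = - ω (Matrix.vecCons y (Matrix.vecCons x v)) := by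
  have h : ∀ z, (ω.curryLeft z).curryLeft z v = 0 := fun z => by
    rw [AlternatingMap.curryLeft_same]; rfl
  have hxy := h (x + y)
  simp only [map_add, AlternatingMap.curryLeft_add, LinearMap.add_apply, AlternatingMap.add_apply,
    h, zero_add, add_zero] at hxy
  exact eq_neg_of_add_eq_zero_right hxy

/-- Expansion of the differential along its first argument (Cartan's formula). -/
theorem dFun_cons (n : ℕ) (ω : Cochain R L (n + 1)) (x : L) (w : Fin (n + 1) → L) :
    dFun (n + 1) ω (Matrix.vecCons x w) =
      - AlternatingMap.alternatizeUncurryFin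
          (ω.curryLeft ∘ₗ (LieAlgebra.ad R L x : L →ₗ[R] L)) w
      - dFun n (ω.curryLeft x) w := by
  have h0 : Finset.Ici (0 : Fin (n + 1)) = Finset.univ := by ext; simp
  simp only [dFun]
  rw [Fin.sum_univ_succ, AlternatingMap.alternatizeUncurryFin_apply, h0, sub_eq_add_neg]
  congr 1
  · rw [← Finset.sum_neg_distrib]
    refine Finset.sum_congr rfl fun j _ => ?_
    have hr : j.removeNth ((0 : Fin (n + 1)).castSucc.removeNth
        (Matrix.vecCons x w : Fin (n + 2) → L)) = j.removeNth w := rfl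
    rw [hr]
    simp [pow_succ]
  · cases n with
    | zero => simp
    | succ n =>
      rw [← Finset.sum_neg_distrib]
      refine Finset.sum_congr rfl fun i _ => ?_
      rw [← Fin.map_succEmb_Ici, Finset.sum_map, ← Finset.sum_neg_distrib]
      refine Finset.sum_congr rfl fun j _ => ?_
      have hr : j.succ.removeNth (i.succ.castSucc.removeNth
          (Matrix.vecCons x w : Fin (n + 3) → L)) =
          Matrix.vecCons x (j.removeNth (i.castSucc.removeNth w)) := by
        funext k
        refine Fin.cases ?_ (fun k => ?_) k
        · simp [Fin.removeNth_apply, Matrix.vecCons]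
        · simp [Fin.removeNth_apply, Matrix.vecCons]
      simp only [Fin.coe_succEmb, hr]
      have hs : ω (Matrix.vecCons ⁅w i.castSucc, w j.succ⁆
          (Matrix.vecCons x (j.removeNth (i.castSucc.removeNth w)))) =
          - ω (Matrix.vecCons x (Matrix.vecCons ⁅w i.castSucc, w j.succ⁆
            (j.removeNth (i.castSucc.removeNth w)))) := map_cons_cons _ _ _ _
      have e1 : (Matrix.vecCons x w : Fin (n + 3) → L) i.succ.castSucc = w i.castSucc := rfl
      have e2 : (Matrix.vecCons x w : Fin (n + 3) → L) j.succ.succ = w j.succ := rfl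
      rw [e1, e2, hs, AlternatingMap.curryLeft_apply_apply]
      simp only [Fin.val_succ]
      ring

theorem dFun_eq_zero (n : ℕ) : ∀ (ω : Cochain R L n) (v : Fin (n + 1) → L) (a b : Fin (n + 1)),
    v a = v b → a ≠ b → dFun n ω v = 0 := by
  induction n with
  | zero => intro ω v a b _ hab; rfl
  | succ n ih =>
    have key : ∀ (ω : Cochain R L (n + 1)) (x : L) (w : Fin (n + 1) → L) (b : Fin (n + 1)),
        w b = x → dFun (n + 1) ω (Matrix.vecCons x w) = 0 := by
      intro ω x w b hb
      let A : Cochain R L (n + 1) :=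
        { dMulti n (ω.curryLeft x) with
          map_eq_zero_of_eq' := fun v i j h hij => by
            have := ih (ω.curryLeft x) v i j h hij
            rw [← dMulti_apply] at this
            exact this }
      have hA : ∀ v, A v = dFun n (ω.curryLeft x) v := fun v => dMulti_apply n _ v
      rw [dFun_cons, ← hA]
      obtain ⟨u, rfl⟩ : ∃ u, w = b.insertNth x u :=
        ⟨b.removeNth w, by rw [← hb, Fin.insertNth_self_removeNth]⟩
      rw [AlternatingMap.map_insertNth, AlternatingMap.map_insertNth, hA]
      have hz : - AlternatingMap.alternatizeUncurryFin
            (ω.curryLeft ∘ₗ (LieAlgebra.ad R L x : L →ₗ[R] L)) (Matrix.vecCons x u)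
          - dFun n (ω.curryLeft x) (Matrix.vecCons x u) = 0 := by
        rw [AlternatingMap.alternatizeUncurryFin_apply, Fin.sum_univ_succ]
        cases n with
        | zero => simp [dFun]
        | succ n =>
          rw [dFun_cons, AlternatingMap.curryLeft_same, AlternatingMap.alternatizeUncurryFin_apply]
          have h0 : dFun n (0 : Cochain R L n) u = 0 := by cases n <;> simp [dFun]
          have e0 : (ω.curryLeft ∘ₗ (LieAlgebra.ad R L x : L →ₗ[R] L))
              ((Matrix.vecCons x u : Fin (n + 2) → L) 0) = 0 := by simp
          rw [h0, e0]
          simp only [AlternatingMap.zero_apply, smul_zero, zero_add, sub_zero, sub_neg_eq_add]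
          rw [neg_add_eq_zero]
          refine Finset.sum_congr rfl fun j _ => ?_
          have hr : j.succ.removeNth (Matrix.vecCons x u : Fin (n + 2) → L) =
              Matrix.vecCons x (j.removeNth u) := by
            funext k
            refine Fin.cases ?_ (fun k => ?_) k
            · simp [Fin.removeNth_apply, Matrix.vecCons]
            · simp [Fin.removeNth_apply, Matrix.vecCons]
          rw [hr]
          simp only [LinearMap.comp_apply, AlternatingMap.curryLeft_apply_apply,
            Matrix.cons_val_succ, Fin.val_succ]
          rw [map_cons_cons, pow_succ, smul_neg, mul_neg_one, neg_smul, neg_neg]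
      rw [← smul_neg, ← smul_sub, hz, smul_zero]
    intro ω v a b hv hab
    obtain ⟨x, w, rfl⟩ : ∃ x w, v = Matrix.vecCons x w :=
      ⟨v 0, Fin.tail v, (Fin.cons_self_tail v).symm⟩
    rcases Fin.eq_zero_or_eq_succ a with rfl | ⟨a, rfl⟩
    · rcases Fin.eq_zero_or_eq_succ b with rfl | ⟨b, rfl⟩
      · exact absurd rfl hab
      · exact key ω x w b hv.symm
    · rcases Fin.eq_zero_or_eq_succ b with rfl | ⟨b, rfl⟩
      · exact key ω x w a hv
      · have hab' : a ≠ b := fun h => hab (by rw [h])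
        have hw : w a = w b := hv
        rw [dFun_cons, ih _ w a b hw hab', AlternatingMap.map_eq_zero_of_eq _ w hw hab']
        simp

/-- The Chevalley–Eilenberg differential `Λⁿ L^* → Λⁿ⁺¹ L^*`. -/
def d (R : Type u) [CommRing R] (L : Type v) [LieRing L] [LieAlgebra R L] (n : ℕ) :
    Cochain R L n →ₗ[R] Cochain R L (n + 1) where
  toFun ω :=
    { toFun := dFun n ω
      map_update_add' := fun {inst} v i x y => by
        rw [Subsingleton.elim inst (instDecidableEqFin _)]
        simp only [← dMulti_apply, MultilinearMap.map_update_add]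
      map_update_smul' := fun {inst} v i c x => by
        rw [Subsingleton.elim inst (instDecidableEqFin _)]
        simp only [← dMulti_apply, MultilinearMap.map_update_smul]
      map_eq_zero_of_eq' := fun v a b h hab => dFun_eq_zero n ω v a b h hab }
  map_add' ω η := by
    ext v
    cases n with
    | zero => simp [dFun]
    | succ n => simp [dFun, mul_add, Finset.sum_add_distrib]
  map_smul' c ω := by
    ext v
    cases n with
    | zero => simp [dFun]
    | succ n => simp [dFun, Finset.mul_sum, mul_left_comm]

/-- The `n`-cocycles. -/
def cocycles (R : Type u) [CommRing R] (L : Type v) [LieRing L] [LieAlgebra R L] (n : ℕ) :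
    Submodule R (Cochain R L n) :=
  LinearMap.ker (d R L n)

/-- The `n`-coboundaries; there are no nonzero ones in degree `0`. -/
def coboundaries (R : Type u) [CommRing R] (L : Type v) [LieRing L] [LieAlgebra R L] :
    (n : ℕ) → Submodule R (Cochain R L n)
  | 0 => ⊥
  | n + 1 => LinearMap.range (d R L n)

/-- The dimension of the quotient space `Z / (B ∩ Z)` (of `Z / B` when `B ≤ Z`). -/
noncomputable def quotientDim {F : Type u} [Field F] {V : Type v} [AddCommGroup V] [Module F V]
    (Z B : Submodule F V) : ℕ :=
  Module.finrank F (Z ⧸ B.submoduleOf Z)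

/-- The `n`-th Betti number of a Lie algebra over a field: the dimension of the cohomology space
`Hⁿ(L)` with trivial coefficients, that is, of the cocycles modulo the coboundaries. -/
noncomputable def betti (F : Type u) [Field F] (L : Type v) [LieRing L] [LieAlgebra F L]
    (n : ℕ) : ℕ :=
  quotientDim (cocycles F L n) (coboundaries F L n)

end

end ChevalleyEilenberg

/-! ## Lie algebras of Vergne type -/

section

/-- A finite-dimensional nilpotent Lie algebra is filiform if `ad(x) ^ (n - 2) ≠ 0` for some `x`,
where `n` is its dimension. -/
structure IsFiliform (F : Type u) [Field F] (L : Type v) [LieRing L] [LieAlgebra F L] :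
    Prop where
  finite : Module.Finite F L
  nilpotent : LieRing.IsNilpotent L
  exists_ad_pow_ne_zero : ∃ x : L, (LieAlgebra.ad F L x) ^ (Module.finrank F L - 2) ≠ 0

/-- A Vergne basis `e₁, …, eₙ`, where `eᵢ` is `b ⟨i - 1, _⟩`; the brackets of basis vectors that
are not listed in its defining relations are zero. -/
structure IsVergneBasis {F : Type u} [Field F] {L : Type v} [LieRing L] [LieAlgebra F L] {n : ℕ}
    (b : Module.Basis (Fin n) F L) : Prop where
  /-- `[e₁, eᵢ] = eᵢ₊₁` for `2 ≤ i ≤ n - 1`. -/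
  lie_one : ∀ (i : ℕ) (_ : 2 ≤ i) (_ : i + 1 ≤ n),
    ⁅b ⟨0, by omega⟩, b ⟨i - 1, by omega⟩⁆ = b ⟨i, by omega⟩
  /-- `[e₁, eₙ] = 0`. -/
  lie_one_last : ∀ _ : 1 ≤ n, ⁅b ⟨0, by omega⟩, b ⟨n - 1, by omega⟩⁆ = 0
  /-- `[eᵢ, eⱼ] = cᵢⱼ eᵢ₊ⱼ` for `2 ≤ i, j` and `i + j ≤ n`. -/
  lie_eq_smul : ∀ (i j : ℕ) (_ : 2 ≤ i) (_ : 2 ≤ j) (_ : i + j ≤ n), ∃ c : F,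
    ⁅b ⟨i - 1, by omega⟩, b ⟨j - 1, by omega⟩⁆ = c • b ⟨i + j - 1, by omega⟩
  /-- `[eᵢ, eⱼ] = 0` for `2 ≤ i, j ≤ n` and `i + j > n`. -/
  lie_eq_zero : ∀ (i j : ℕ) (_ : 2 ≤ i) (_ : 2 ≤ j) (_ : i ≤ n) (_ : j ≤ n) (_ : n < i + j),
    ⁅b ⟨i - 1, by omega⟩, b ⟨j - 1, by omega⟩⁆ = 0

/-- A filiform Lie algebra is of Vergne type if it has a Vergne basis. -/
def IsVergneType (F : Type u) [Field F] (L : Type v) [LieRing L] [LieAlgebra F L] : Prop :=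
  IsFiliform F L ∧
    ∃ b : Module.Basis (Fin (Module.finrank F L)) F L, IsVergneBasis b

end

/-!
Let `e = e₁`, let `e₂*` be the coordinate form of `e₂`, and put `φ = t e₂*` for a scalar `t`. In
characteristic two the square of the derivation `ad e` is again a derivation, and `φ` vanishes on
all brackets, so that
`[x, y]' = [x, y] + φ(x) [e, [e, y]] - φ(y) [e, [e, x]]`
is a Lie bracket (`LieAlgebra.exists_deformation`). It has the same Vergne basis, with `c₂,ⱼ`
replaced by `c₂,ⱼ + t` for `j ≥ 3` (`IsVergneBasis.map_deformation`).

The Betti numbers do not change. Write `θ` for the derivation of the algebra of forms that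
extends the transpose of `ad e`, and `ι` for the contraction with `e`. The new differential is
`d - φ ∧ θ_{(ad e)²}` (`d_compLinearMap`), and `θ_{(ad e)²} = θ²` in characteristic two
(`lieDeriv_lieDeriv_self`). Let `S = φ ∧ θ ι`. As `φ` is closed and `θ` commutes with `d`, Cartan's
formula gives `d S - S d = φ ∧ θ²`, and `S² = 0` since `φ(e) = 0`. Hence `1 + S` is an isomorphism
from the old complex onto the new one (`betti_deformation`).

Whether `c₂,₃` is zero depends only on the lower central series
(`IsVergneBasis.centralizesDeeper_iff`), in dimension at least five. Choosing `t` such that exactly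
one of `c₂,₃` and `c₂,₃ + t` is zero makes the two algebras non-isomorphic. A fixed `t = 1` would
not do over a field with more than two elements, where rescaling the basis can identify two algebras
with different nonzero values of `c₂,₃`.
-/

namespace AlternatingMap

/-! ### Exterior multiplication and Lie derivatives of alternating forms -/

section

variable {R : Type*} [CommRing R] {M : Type*} [AddCommGroup M] [Module R M]

theorem ext_curryLeft {n : ℕ} {ω η : M [⋀^Fin (n + 1)]→ₗ[R] R}
    (h : ∀ x, ω.curryLeft x = η.curryLeft x) : ω = η := by
  ext v
  rw [← Fin.cons_self_tail v]
  exact congrArg (fun ζ => ζ (Fin.tail v)) (h (v 0))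

theorem curryLeft_alternatizeUncurryFin_zero (f : M →ₗ[R] M [⋀^Fin 0]→ₗ[R] R) (x : M) :
    (alternatizeUncurryFin f).curryLeft x = f x := by
  ext w
  rw [curryLeft_apply_apply, alternatizeUncurryFin_apply, Fin.sum_univ_one]
  simp [Subsingleton.elim _ w]

theorem curryLeft_alternatizeUncurryFin_succ {n : ℕ} (f : M →ₗ[R] M [⋀^Fin (n + 1)]→ₗ[R] R)
    (x : M) :
    (alternatizeUncurryFin f).curryLeft x = f x -
      alternatizeUncurryFin (((curryLeftLinearMap (R := R) (M := M) (N := R)).flip x) ∘ₗ f) := by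
  ext w
  rw [curryLeft_apply_apply, alternatizeUncurryFin_apply, Fin.sum_univ_succ, sub_apply,
    alternatizeUncurryFin_apply, sub_eq_add_neg, ← Finset.sum_neg_distrib]
  congr 1
  · simp [Matrix.vecCons]
  · refine Finset.sum_congr rfl fun j _ => ?_
    have hr : j.succ.removeNth (Matrix.vecCons x w : Fin (n + 2) → M) =
        Matrix.vecCons x (j.removeNth w) := by
      funext k
      refine Fin.cases ?_ (fun k => ?_) k <;> simp [Fin.removeNth_apply, Matrix.vecCons]
    rw [hr]
    simp [pow_succ]

/-- Exterior multiplication `ω ↦ φ ∧ ω` by a linear form `φ`. -/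
def wedge (φ : M →ₗ[R] R) (n : ℕ) : (M [⋀^Fin n]→ₗ[R] R) →ₗ[R] M [⋀^Fin (n + 1)]→ₗ[R] R :=
  alternatizeUncurryFinLM ∘ₗ LinearMap.smulRightₗ φ

/-- The derivation of the algebra of alternating forms that extends the transpose of `Δ`:
`(θ_Δ ω)(v₁, …, vₙ) = ∑ᵢ ω(v₁, …, Δ vᵢ, …, vₙ)`. In positive degree it is written as the
alternatization of `x ↦ ι_{Δ x} ω`. -/
def lieDeriv (Δ : M →ₗ[R] M) :
    (n : ℕ) → (M [⋀^Fin n]→ₗ[R] R) →ₗ[R] M [⋀^Fin n]→ₗ[R] R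
  | 0 => 0
  | _ + 1 => alternatizeUncurryFinLM ∘ₗ LinearMap.lcomp R _ Δ ∘ₗ curryLeftLinearMap

theorem wedge_apply (φ : M →ₗ[R] R) {n : ℕ} (ω : M [⋀^Fin n]→ₗ[R] R) :
    wedge φ n ω = alternatizeUncurryFin (φ.smulRight ω) := rfl

@[simp]
theorem lieDeriv_zero_apply (Δ : M →ₗ[R] M) (ω : M [⋀^Fin 0]→ₗ[R] R) : lieDeriv Δ 0 ω = 0 := rfl

theorem lieDeriv_succ_apply (Δ : M →ₗ[R] M) {n : ℕ} (ω : M [⋀^Fin (n + 1)]→ₗ[R] R) :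
    lieDeriv Δ (n + 1) ω = alternatizeUncurryFin (ω.curryLeft ∘ₗ Δ) := rfl

theorem lieDeriv_add_left (Δ Δ' : M →ₗ[R] M) {n : ℕ} (ω : M [⋀^Fin n]→ₗ[R] R) :
    lieDeriv (Δ + Δ') n ω = lieDeriv Δ n ω + lieDeriv Δ' n ω := by
  cases n with
  | zero => simp
  | succ n => simp [lieDeriv_succ_apply, LinearMap.comp_add]

theorem lieDeriv_smul_left (c : R) (Δ : M →ₗ[R] M) {n : ℕ} (ω : M [⋀^Fin n]→ₗ[R] R) :
    lieDeriv (c • Δ) n ω = c • lieDeriv Δ n ω := by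
  cases n with
  | zero => simp
  | succ n => simp [lieDeriv_succ_apply, LinearMap.comp_smul]

theorem lieDeriv_smulRight (φ : M →ₗ[R] R) (y : M) {n : ℕ} (ω : M [⋀^Fin (n + 1)]→ₗ[R] R) :
    lieDeriv (φ.smulRight y) (n + 1) ω = wedge φ n (ω.curryLeft y) := by
  rw [lieDeriv_succ_apply, wedge_apply]
  congr 1
  ext x : 1
  simp

theorem curryLeft_wedge_zero (φ : M →ₗ[R] R) (ω : M [⋀^Fin 0]→ₗ[R] R) (x : M) :
    (wedge φ 0 ω).curryLeft x = φ x • ω := by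
  rw [wedge_apply, curryLeft_alternatizeUncurryFin_zero]; rfl

theorem curryLeft_wedge_succ (φ : M →ₗ[R] R) {n : ℕ} (ω : M [⋀^Fin (n + 1)]→ₗ[R] R) (x : M) :
    (wedge φ (n + 1) ω).curryLeft x = φ x • ω - wedge φ n (ω.curryLeft x) := by
  rw [wedge_apply, curryLeft_alternatizeUncurryFin_succ, wedge_apply]
  rfl

theorem curryLeft_comm {n : ℕ} (ω : M [⋀^Fin (n + 2)]→ₗ[R] R) (x y : M) :
    (ω.curryLeft x).curryLeft y = -(ω.curryLeft y).curryLeft x := by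
  have h := ω.curryLeft_same (x + y)
  simp only [map_add, curryLeft_add, LinearMap.add_apply, curryLeft_same, zero_add,
    add_zero] at h
  exact eq_neg_of_add_eq_zero_right h

theorem curryLeft_lieDeriv (Δ : M →ₗ[R] M) {n : ℕ} (ω : M [⋀^Fin (n + 1)]→ₗ[R] R) (x : M) :
    (lieDeriv Δ (n + 1) ω).curryLeft x = lieDeriv Δ n (ω.curryLeft x) + ω.curryLeft (Δ x) := by
  rw [lieDeriv_succ_apply]
  cases n with
  | zero => rw [curryLeft_alternatizeUncurryFin_zero]; simp
  | succ n =>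
    rw [curryLeft_alternatizeUncurryFin_succ, lieDeriv_succ_apply, sub_eq_add_neg]
    refine (add_comm _ _).trans ?_
    congr 1
    rw [← neg_one_smul R, ← alternatizeUncurryFin_smul]
    congr 1
    ext y : 1
    simp [curryLeft_comm ω x]

theorem lieDeriv_wedge {φ : M →ₗ[R] R} {Δ : M →ₗ[R] M} (h : ∀ x, φ (Δ x) = 0) {n : ℕ}
    (ω : M [⋀^Fin n]→ₗ[R] R) :
    lieDeriv Δ (n + 1) (wedge φ n ω) = wedge φ n (lieDeriv Δ n ω) := by
  induction n with
  | zero =>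
    refine ext_curryLeft fun x => ?_
    simp [curryLeft_lieDeriv, curryLeft_wedge_zero, h]
  | succ n ih =>
    refine ext_curryLeft fun x => ?_
    simp only [curryLeft_lieDeriv, curryLeft_wedge_succ, h, map_sub, map_add, map_smul, ih]
    module

theorem wedge_wedge_self (φ : M →ₗ[R] R) {n : ℕ} (ω : M [⋀^Fin n]→ₗ[R] R) :
    wedge φ (n + 1) (wedge φ n ω) = 0 := by
  induction n with
  | zero =>
    refine ext_curryLeft fun x => ?_
    simp [curryLeft_wedge_zero, curryLeft_wedge_succ]
  | succ n ih =>
    refine ext_curryLeft fun x => ?_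
    simp [curryLeft_wedge_succ, ih]

/-- `[θ_A, θ_B] = θ_{[B, A]}`; the order is reversed because forms are contravariant. -/
theorem lieDeriv_comm (A B : M →ₗ[R] M) {n : ℕ} (ω : M [⋀^Fin n]→ₗ[R] R) :
    lieDeriv A n (lieDeriv B n ω) - lieDeriv B n (lieDeriv A n ω) =
      lieDeriv (B ∘ₗ A - A ∘ₗ B) n ω := by
  induction n with
  | zero => simp
  | succ n ih =>
    refine ext_curryLeft fun x => ?_
    have hsub : ∀ η ζ : M [⋀^Fin (n + 1)]→ₗ[R] R,
        (η - ζ).curryLeft x = η.curryLeft x - ζ.curryLeft x := fun _ _ => rfl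
    simp only [hsub, curryLeft_lieDeriv, map_add, ← ih, LinearMap.sub_apply,
      LinearMap.comp_apply, map_sub]
    abel

/-- In characteristic two the cross terms of the square of the derivation `θ_Δ` cancel, so that
this square is again a derivation. -/
theorem lieDeriv_lieDeriv_self [CharP R 2] (Δ : M →ₗ[R] M) {n : ℕ} (ω : M [⋀^Fin n]→ₗ[R] R) :
    lieDeriv Δ n (lieDeriv Δ n ω) = lieDeriv (Δ ∘ₗ Δ) n ω := by
  induction n with
  | zero => simp
  | succ n ih =>
    refine ext_curryLeft fun x => ?_
    have h2 : ∀ η : M [⋀^Fin n]→ₗ[R] R, η + η = 0 := fun η => by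
      rw [← two_smul R, CharTwo.two_eq_zero, zero_smul]
    simp only [curryLeft_lieDeriv, map_add, ← ih, LinearMap.comp_apply]
    rw [add_assoc, ← add_assoc (lieDeriv Δ n (ω.curryLeft (Δ x))), h2, zero_add]

end

end AlternatingMap

namespace ChevalleyEilenberg

open AlternatingMap

/-! ### Cartan calculus on the Chevalley–Eilenberg complex -/

section

variable {R : Type*} [CommRing R] {L : Type*} [LieRing L] [LieAlgebra R L]

/-- Cartan's formula `ι_x d = -θ_x - d ι_x`: with the sign convention of `d`, the Lie derivative
along `x` is `-θ_x`. -/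
theorem curryLeft_d {n : ℕ} (ω : Cochain R L (n + 1)) (x : L) :
    (d R L (n + 1) ω).curryLeft x =
      -lieDeriv (LieAlgebra.ad R L x : L →ₗ[R] L) (n + 1) ω - d R L n (ω.curryLeft x) := by
  ext w
  exact dFun_cons n ω x w

@[simp]
theorem d_zero_apply (ω : Cochain R L 0) : d R L 0 ω = 0 := by
  ext v; rfl

theorem d_wedge {φ : L →ₗ[R] R} (h : ∀ x y : L, φ ⁅x, y⁆ = 0) {n : ℕ} (ω : Cochain R L n) :
    d R L (n + 1) (wedge φ n ω) = -wedge φ (n + 1) (d R L n ω) := by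
  have hneg : ∀ {m : ℕ} (η : Cochain R L (m + 1)) (x : L),
    (-η).curryLeft x = -η.curryLeft x := fun _ _ => rfl
  induction n with
  | zero =>
    refine ext_curryLeft fun x => ?_
    rw [curryLeft_d, curryLeft_wedge_zero,
      lieDeriv_wedge (Δ := (LieAlgebra.ad R L x : L →ₗ[R] L)) (fun y => h x y)]
    simp
  | succ n ih =>
    refine ext_curryLeft fun x => ?_
    rw [curryLeft_d, curryLeft_wedge_succ, hneg, curryLeft_wedge_succ, curryLeft_d,
      lieDeriv_wedge (Δ := (LieAlgebra.ad R L x : L →ₗ[R] L)) (fun y => h x y)]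
    simp only [map_sub, map_smul, ih, map_neg]
    abel

theorem d_lieDeriv {D : L →ₗ[R] L} (h : ∀ x y : L, D ⁅x, y⁆ = ⁅D x, y⁆ + ⁅x, D y⁆) {n : ℕ}
    (ω : Cochain R L n) : d R L n (lieDeriv D n ω) = lieDeriv D (n + 1) (d R L n ω) := by
  induction n with
  | zero => simp
  | succ n ih =>
    refine ext_curryLeft fun x => ?_
    have had : (LieAlgebra.ad R L (D x) : L →ₗ[R] L) =
        D ∘ₗ (LieAlgebra.ad R L x : L →ₗ[R] L) - (LieAlgebra.ad R L x : L →ₗ[R] L) ∘ₗ D := by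
      ext y; simp [h]
    simp only [curryLeft_d, curryLeft_lieDeriv, map_add, map_sub, map_neg, ih, had,
      ← lieDeriv_comm]
    abel

end

/-! ### Cohomology of the deformed bracket -/

/-- Two Lie algebras have the same Betti numbers if their Chevalley–Eilenberg complexes are
isomorphic. -/
theorem betti_eq_of_equiv {F : Type u} [Field F] {L L' : Type v} [LieRing L] [LieAlgebra F L]
    [LieRing L'] [LieAlgebra F L'] (Φ : ∀ n, Cochain F L n ≃ₗ[F] Cochain F L' n)
    (hΦ : ∀ n ω, Φ (n + 1) (d F L n ω) = d F L' n (Φ n ω)) (k : ℕ) :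
    betti F L k = betti F L' k := by
  have hZ : (cocycles F L k).map (Φ k : Cochain F L k →ₗ[F] Cochain F L' k) =
      cocycles F L' k := by
    ext ω
    simp only [cocycles, Submodule.mem_map, LinearMap.mem_ker]
    constructor
    · rintro ⟨η, hη, rfl⟩
      simpa [hη] using (hΦ k η).symm
    · intro hω
      refine ⟨(Φ k).symm ω, (Φ (k + 1)).injective ?_, by simp⟩
      simpa [hω] using hΦ k ((Φ k).symm ω)
  have hB : ∀ ω, Φ k ω ∈ coboundaries F L' k ↔ ω ∈ coboundaries F L k := by
    intro ω
    cases k with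
    | zero => simp [coboundaries]
    | succ k =>
      simp only [coboundaries, LinearMap.mem_range]
      constructor
      · rintro ⟨η, hη⟩
        refine ⟨(Φ k).symm η, (Φ (k + 1)).injective ?_⟩
        rw [hΦ, LinearEquiv.apply_symm_apply, hη]
      · rintro ⟨η, rfl⟩
        exact ⟨Φ k η, (hΦ k η).symm⟩
  refine LinearEquiv.finrank_eq (Submodule.Quotient.equiv _ _
    ((Φ k).submoduleMap (cocycles F L k) ≪≫ₗ LinearEquiv.ofEq _ _ hZ) ?_)
  ext ω
  simp only [Submodule.mem_map, Submodule.submoduleOf, Submodule.mem_comap]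
  constructor
  · rintro ⟨η, hη, rfl⟩
    exact (hB η).2 hη
  · intro hω
    obtain ⟨η, hη⟩ := ((Φ k).submoduleMap (cocycles F L k) ≪≫ₗ LinearEquiv.ofEq _ _ hZ).surjective ω
    refine ⟨η, ?_, hη⟩
    rw [← hη] at hω
    exact (hB η).1 hω

section

variable {R : Type*} [CommRing R] {L L' : Type*} [LieRing L] [LieAlgebra R L] [LieRing L']
  [LieAlgebra R L']

theorem lieDeriv_compLinearMap {M M' : Type*} [AddCommGroup M] [Module R M] [AddCommGroup M']
    [Module R M'] (τ : M' →ₗ[R] M) {A : M →ₗ[R] M} {A' : M' →ₗ[R] M'}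
    (h : ∀ x, τ (A' x) = A (τ x)) {n : ℕ} (ω : M [⋀^Fin n]→ₗ[R] R) :
    lieDeriv A' n (ω.compLinearMap τ) = (lieDeriv A n ω).compLinearMap τ := by
  induction n with
  | zero => simp
  | succ n ih =>
    refine ext_curryLeft fun x => ?_
    simp only [curryLeft_lieDeriv, curryLeft_compLinearMap, ih, h, add_compLinearMap]

/-- The differential of the bracket `[x, y] + φ(x) Δ y - φ(y) Δ x`, which is carried by `L'`, is
`d - φ ∧ θ_Δ`. -/
theorem d_compLinearMap {φ : L →ₗ[R] R} {Δ : L →ₗ[R] L} (τ : L' →ₗ[R] L)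
    (hτ : ∀ x y, τ ⁅x, y⁆ = ⁅τ x, τ y⁆ + φ (τ x) • Δ (τ y) - φ (τ y) • Δ (τ x)) {n : ℕ}
    (ω : Cochain R L n) :
    d R L' n (ω.compLinearMap τ) = (d R L n ω - wedge φ n (lieDeriv Δ n ω)).compLinearMap τ := by
  induction n with
  | zero => simp
  | succ n ih =>
    refine ext_curryLeft fun x => ?_
    have had : ∀ y, τ (LieAlgebra.ad R L' x y) =
        ((LieAlgebra.ad R L (τ x) : L →ₗ[R] L) + φ (τ x) • Δ
          + (-1 : R) • φ.smulRight (Δ (τ x))) (τ y) := fun y => by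
      simp [hτ, sub_eq_add_neg]
    have hsub : ∀ η ζ : Cochain R L (n + 2),
        (η - ζ).curryLeft (τ x) = η.curryLeft (τ x) - ζ.curryLeft (τ x) := fun _ _ => rfl
    have hd : ∀ η ζ : Cochain R L (n + 1),
        -η.compLinearMap τ - ζ.compLinearMap τ = (-η - ζ).compLinearMap τ := fun _ _ => rfl
    rw [curryLeft_d, curryLeft_compLinearMap, curryLeft_compLinearMap, ih,
      lieDeriv_compLinearMap (A' := (LieAlgebra.ad R L' x : L' →ₗ[R] L')) τ had, hd, hsub,
      curryLeft_d, curryLeft_wedge_succ, curryLeft_lieDeriv, lieDeriv_add_left,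
      lieDeriv_add_left, lieDeriv_smul_left, lieDeriv_smul_left, lieDeriv_smulRight, map_add]
    congr 1
    module

/-- The operator `ω ↦ φ ∧ θ_D (ι_e ω)` on cochains, where `ι_e` is the contraction with `e`;
it is zero in degree `0`. -/
def twist (φ : L →ₗ[R] R) (D : L →ₗ[R] L) (e : L) :
    (n : ℕ) → Cochain R L n →ₗ[R] Cochain R L n
  | 0 => 0
  | n + 1 => wedge φ n ∘ₗ lieDeriv D n ∘ₗ (curryLeftLinearMap (N := R)).flip e

@[simp]
theorem twist_zero_apply (φ : L →ₗ[R] R) (D : L →ₗ[R] L) (e : L) (ω : Cochain R L 0) :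
    twist φ D e 0 ω = 0 := rfl

theorem twist_succ_apply (φ : L →ₗ[R] R) (D : L →ₗ[R] L) (e : L) {n : ℕ}
    (ω : Cochain R L (n + 1)) :
    twist φ D e (n + 1) ω = wedge φ n (lieDeriv D n (ω.curryLeft e)) := rfl

theorem twist_wedge {φ : L →ₗ[R] R} {D : L →ₗ[R] L} {e : L} (hφD : ∀ x, φ (D x) = 0)
    (hφe : φ e = 0) {n : ℕ} (ω : Cochain R L n) :
    twist φ D e (n + 1) (wedge φ n ω) = 0 := by
  cases n with
  | zero => simp [twist_succ_apply]
  | succ n =>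
    rw [twist_succ_apply, curryLeft_wedge_succ, hφe, zero_smul, zero_sub, map_neg, map_neg,
      lieDeriv_wedge hφD, wedge_wedge_self, neg_zero]

theorem twist_twist {φ : L →ₗ[R] R} {D : L →ₗ[R] L} {e : L} (hφD : ∀ x, φ (D x) = 0)
    (hφe : φ e = 0) {n : ℕ} (ω : Cochain R L n) :
    twist φ D e n (twist φ D e n ω) = 0 := by
  cases n with
  | zero => simp
  | succ n => rw [twist_succ_apply _ _ _ ω, twist_wedge hφD hφe]

/-- The commutator of the differential with `φ ∧ θ ι`, for `θ = θ_{ad e}` and `ι = ι_e`, is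
`φ ∧ θ²`, by Cartan's formula. -/
theorem d_twist {φ : L →ₗ[R] R} (hφ : ∀ x y : L, φ ⁅x, y⁆ = 0) (e : L) {n : ℕ}
    (ω : Cochain R L n) :
    d R L n (twist φ (LieAlgebra.ad R L e) e n ω) =
      twist φ (LieAlgebra.ad R L e) e (n + 1) (d R L n ω) + wedge φ n
        (lieDeriv (LieAlgebra.ad R L e) n (lieDeriv (LieAlgebra.ad R L e) n ω)) := by
  cases n with
  | zero => simp
  | succ n =>
    rw [twist_succ_apply, twist_succ_apply, d_wedge hφ, d_lieDeriv (by simp), curryLeft_d]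
    simp only [map_sub, map_neg]
    abel

/-- In characteristic two, the bracket `[x, y] + φ(x) [e, [e, y]] - φ(y) [e, [e, x]]` has the
same Betti numbers as the bracket `[x, y]`: the isomorphism `1 + φ ∧ θ_{ad e} ι_e` of the
spaces of cochains intertwines the two differentials. -/
theorem betti_deformation {F : Type u} [Field F] [CharP F 2] {L L' : Type v} [LieRing L]
    [LieAlgebra F L] [LieRing L'] [LieAlgebra F L'] {φ : L →ₗ[F] F} {e : L}
    (hφ : ∀ x y : L, φ ⁅x, y⁆ = 0) (hφe : φ e = 0) (τ : L' ≃ₗ[F] L)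
    (hτ : ∀ x y, τ ⁅x, y⁆ =
      ⁅τ x, τ y⁆ + φ (τ x) • ⁅e, ⁅e, τ y⁆⁆ - φ (τ y) • ⁅e, ⁅e, τ x⁆⁆) (k : ℕ) :
    betti F L k = betti F L' k := by
  let D : L →ₗ[F] L := LieAlgebra.ad F L e
  have hφD : ∀ x, φ (D x) = 0 := fun x => hφ e x
  let Ψ : ∀ n, Cochain F L n ≃ₗ[F] Cochain F L n := fun n =>
    LinearEquiv.ofLinearMap (LinearMap.id + twist φ D e n) (LinearMap.id - twist φ D e n)
      (by ext1 ω; simp [twist_twist hφD hφe]) (by ext1 ω; simp [twist_twist hφD hφe])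
  have hΨ : ∀ n ω, Ψ n ω = ω + twist φ D e n ω := fun _ _ => rfl
  have hT : ∀ n ω, domLCongr F F (Fin n) F τ.symm ω =
      ω.compLinearMap (τ : L' →ₗ[F] L) := fun _ _ => rfl
  refine betti_eq_of_equiv (fun n => Ψ n ≪≫ₗ domLCongr F F (Fin n) F τ.symm) (fun n ω => ?_) k
  rw [LinearEquiv.trans_apply, LinearEquiv.trans_apply, hT, hT,
    d_compLinearMap (φ := φ) (Δ := D ∘ₗ D) (τ : L' →ₗ[F] L) hτ, hΨ, hΨ]
  congr 1
  have h0 : wedge φ n (lieDeriv (D ∘ₗ D) n (twist φ D e n ω)) = 0 := by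
    cases n with
    | zero => simp
    | succ n =>
      rw [twist_succ_apply, lieDeriv_wedge (by simp [hφD]), wedge_wedge_self]
  rw [map_add, map_add, map_add, h0, d_twist hφ, lieDeriv_lieDeriv_self]
  simp only [D]
  abel

end

end ChevalleyEilenberg

/-! ### The deformed Lie algebra -/

/-- If `φ` vanishes on brackets and `Δ` is a derivation with values in `ker φ`, then
`[x, y] + φ(x) Δ y - φ(y) Δ x` is a Lie bracket. The Lie algebra is given together with a linear
identification `τ` with `L`. -/
theorem LieAlgebra.exists_deformation {R : Type u} [CommRing R] {L : Type v} [LieRing L]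
    [LieAlgebra R L] {φ : L →ₗ[R] R} {Δ : L →ₗ[R] L} (hφ : ∀ x y : L, φ ⁅x, y⁆ = 0)
    (hφΔ : ∀ x, φ (Δ x) = 0) (hΔ : ∀ x y : L, Δ ⁅x, y⁆ = ⁅Δ x, y⁆ + ⁅x, Δ y⁆) :
    ∃ (L' : Type v) (_ : LieRing L') (_ : LieAlgebra R L') (τ : L' ≃ₗ[R] L),
      ∀ x y, τ ⁅x, y⁆ = ⁅τ x, τ y⁆ + φ (τ x) • Δ (τ y) - φ (τ y) • Δ (τ x) := by
  let br : L → L → L := fun x y => ⁅x, y⁆ + φ x • Δ y - φ y • Δ x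
  have jacobi : ∀ x y z, br x (br y z) = br (br x y) z + br y (br x z) := fun x y z => by
    have hJ : ⁅x, ⁅y, z⁆⁆ = ⁅⁅x, y⁆, z⁆ + ⁅y, ⁅x, z⁆⁆ := leibniz_lie x y z
    have h1 : ⁅Δ x, y⁆ = -⁅y, Δ x⁆ := (lie_skew _ _).symm
    simp only [br, map_add, map_sub, map_smul, hφ, hφΔ, hΔ, lie_add, lie_sub, lie_smul, add_lie,
      sub_lie, smul_lie, hJ, h1, smul_eq_mul]
    module
  have smul : ∀ (t : R) x y, br x (t • y) = t • br x y := fun t x y => by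
    simp only [br, lie_smul, map_smul, smul_eq_mul]
    module
  -- A copy of the type `L` keeps the two brackets apart.
  let I : LieRing (ULift.{v} L) :=
    { bracket := fun x y => ⟨br x.down y.down⟩
      add_lie := fun x y z => congrArg ULift.up <| by
        simp only [br, ULift.add_down, add_lie, map_add]; module
      lie_add := fun x y z => congrArg ULift.up <| by
        simp only [br, ULift.add_down, lie_add, map_add]; module
      lie_self := fun x => congrArg ULift.up <| by simp [br]
      leibniz_lie := fun x y z => congrArg ULift.up <| jacobi x.down y.down z.down }
  let J : LieAlgebra R (ULift.{v} L) :=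
    { lie_smul := fun t x y => congrArg ULift.up <| smul t x.down y.down }
  exact ⟨ULift.{v} L, I, J, ULift.moduleEquiv, fun x y => rfl⟩

/-! ### Vergne bases and the lower central series -/

/-- A property of the lower central series `γ₁ ⊇ γ₂ ⊇ …` of a Lie algebra, in Mathlib's indexing
`γᵢ = lowerCentralSeries (i - 1)`: the elements that move `γ₂` into `γ₄` move it into `γ₅`. -/
def LieAlgebra.CentralizesDeeper (F : Type u) [CommRing F] (L : Type v) [LieRing L]
    [LieAlgebra F L] : Prop :=
  ∀ x : L, (∀ y ∈ LieModule.lowerCentralSeries F L L 1,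
      ⁅x, y⁆ ∈ LieModule.lowerCentralSeries F L L 3) →
    ∀ y ∈ LieModule.lowerCentralSeries F L L 1, ⁅x, y⁆ ∈ LieModule.lowerCentralSeries F L L 4

theorem LieAlgebra.CentralizesDeeper.of_equiv {F : Type u} [CommRing F] {L L' : Type v}
    [LieRing L] [LieAlgebra F L] [LieRing L'] [LieAlgebra F L'] (e : L ≃ₗ⁅F⁆ L')
    (h : LieAlgebra.CentralizesDeeper F L) : LieAlgebra.CentralizesDeeper F L' := by
  have hmem : ∀ k x, e x ∈ LieModule.lowerCentralSeries F L' L' k ↔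
      x ∈ LieModule.lowerCentralSeries F L L k := by
    have hle : ∀ {A B : Type v} [LieRing A] [LieAlgebra F A] [LieRing B] [LieAlgebra F B]
        (f : A ≃ₗ⁅F⁆ B) k x, x ∈ LieModule.lowerCentralSeries F A A k →
          f x ∈ LieModule.lowerCentralSeries F B B k := fun f k x hx =>
      LieIdeal.map_lowerCentralSeries_le k (LieIdeal.mem_map (f := f.toLieHom) hx)
    refine fun k x => ⟨fun hx => ?_, hle e k x⟩
    simpa using hle e.symm k _ hx
  intro x hx y hy
  obtain ⟨x, rfl⟩ : ∃ x', e x' = x := e.surjective x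
  obtain ⟨y, rfl⟩ : ∃ y', e y' = y := e.surjective y
  rw [← LieEquiv.map_lie, hmem]
  refine h x (fun z hz => ?_) y ((hmem _ _).1 hy)
  rw [← hmem, LieEquiv.map_lie]
  exact hx _ ((hmem _ _).2 hz)

namespace IsVergneBasis

section

variable {F : Type u} [Field F] {L : Type v} [LieRing L] [LieAlgebra F L] {n : ℕ}
  {b : Module.Basis (Fin n) F L}

theorem lie_zero (hb : IsVergneBasis b) {j : ℕ} (hj : 1 ≤ j) (hjn : j + 1 < n) :
    ⁅b ⟨0, by omega⟩, b ⟨j, by omega⟩⁆ = b ⟨j + 1, hjn⟩ :=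
  hb.lie_one (j + 1) (by omega) (by omega)

/-- With indices starting from `0`, the bracket of `bᵢ` and `bⱼ` is a multiple of
`bᵢ₊ⱼ₊₁`. -/
theorem repr_lie_basis (hb : IsVergneBasis b) (i j k : Fin n) (h : (k : ℕ) ≠ i + j + 1) :
    b.repr ⁅b i, b j⁆ k = 0 := by
  have hz : ∀ j : Fin n, (k : ℕ) ≠ j + 1 → ∀ h0 : 0 < n, b.repr ⁅b ⟨0, h0⟩, b j⁆ k = 0 := by
    intro j hj h0
    rcases Nat.eq_zero_or_pos (j : ℕ) with h1 | h1
    · have : j = ⟨0, h0⟩ := Fin.ext h1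
      simp [this]
    · by_cases h2 : (j : ℕ) + 1 < n
      · have := hb.lie_zero h1 h2
        rw [Fin.eta] at this
        rw [this, b.repr_self, Finsupp.single_apply, if_neg]
        intro h3
        exact hj (by rw [← h3])
      · have := hb.lie_one_last (by omega)
        have hj' : j = ⟨n - 1, by omega⟩ := Fin.ext (by simp only; omega)
        rw [hj', this]
        simp
  rcases Nat.eq_zero_or_pos (i : ℕ) with hi | hi
  · have : i = ⟨0, by omega⟩ := Fin.ext hi
    rw [this]
    exact hz j (by omega) _
  rcases Nat.eq_zero_or_pos (j : ℕ) with hj | hj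
  · have : j = ⟨0, by omega⟩ := Fin.ext hj
    rw [this, ← lie_skew, map_neg, Finsupp.neg_apply, hz i (by omega), neg_zero]
  by_cases hij : (i : ℕ) + j + 1 < n
  · obtain ⟨c, hc⟩ := hb.lie_eq_smul (i + 1) (j + 1) (by omega) (by omega) (by omega)
    simp only [Nat.add_sub_cancel, Fin.eta] at hc
    rw [hc, map_smul, b.repr_self, Finsupp.smul_apply, Finsupp.single_apply, if_neg, smul_zero]
    intro h3
    rw [← h3] at h
    simp only at h
    omega
  · have hc := hb.lie_eq_zero (i + 1) (j + 1) (by omega) (by omega) (by omega) (by omega)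
      (by omega)
    simp only [Nat.add_sub_cancel, Fin.eta] at hc
    rw [hc]
    simp

theorem repr_lie (x y : L) (k : Fin n) : b.repr ⁅x, y⁆ k =
    ∑ i, ∑ j, b.repr x i * (b.repr y j * b.repr ⁅b i, b j⁆ k) := by
  conv_lhs => rw [← b.sum_repr x, ← b.sum_repr y, sum_lie_sum]
  simp only [map_sum, Finsupp.finsetSum_apply, smul_lie, lie_smul, map_smul, Finsupp.smul_apply,
    smul_eq_mul]
  exact Finset.sum_congr rfl fun i _ => Finset.sum_congr rfl fun j _ => mul_left_comm _ _ _

theorem repr_lie_eq_zero (hb : IsVergneBasis b) {x y : L} {p q : ℕ}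
    (hx : ∀ i : Fin n, (i : ℕ) < p → b.repr x i = 0)
    (hy : ∀ i : Fin n, (i : ℕ) < q → b.repr y i = 0) (k : Fin n) (hk : (k : ℕ) < p + q + 1) :
    b.repr ⁅x, y⁆ k = 0 := by
  rw [repr_lie]
  refine Finset.sum_eq_zero fun i _ => Finset.sum_eq_zero fun j _ => ?_
  by_cases hi : (i : ℕ) < p
  · rw [hx i hi, zero_mul]
  by_cases hj : (j : ℕ) < q
  · rw [hy j hj, zero_mul, mul_zero]
  rw [hb.repr_lie_basis i j k (by omega), mul_zero, mul_zero]

theorem repr_lie_lt_two (hb : IsVergneBasis b) (x y : L) (k : Fin n) (hk : (k : ℕ) < 2) :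
    b.repr ⁅x, y⁆ k = 0 := by
  rw [repr_lie]
  refine Finset.sum_eq_zero fun i _ => Finset.sum_eq_zero fun j _ => ?_
  by_cases hij : i = j
  · simp [hij]
  · have : (i : ℕ) ≠ j := fun h => hij (Fin.ext h)
    rw [hb.repr_lie_basis i j k (by omega), mul_zero, mul_zero]

/-- With indices starting from `0`, `γ₂, γ₃, …` are spanned by the basis vectors from index
`2`, `3`, … on. The first term `γ₁ = L` does not fit the pattern, since `b₁` is not a bracket. -/
theorem mem_lowerCentralSeries (hb : IsVergneBasis b) (k : ℕ) (x : L) :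
    x ∈ LieModule.lowerCentralSeries F L L (k + 1) ↔
      ∀ i : Fin n, (i : ℕ) < k + 2 → b.repr x i = 0 := by
  constructor
  · -- In the first step the second factor is unrestricted, and `repr_lie_lt_two` takes over.
    have hstep : ∀ (k : ℕ) (p : ℕ), (∀ x : L, ∀ y ∈ LieModule.lowerCentralSeries F L L k,
        ∀ i : Fin n, (i : ℕ) < p → b.repr ⁅x, y⁆ i = 0) →
        ∀ x ∈ LieModule.lowerCentralSeries F L L (k + 1),
          ∀ i : Fin n, (i : ℕ) < p → b.repr x i = 0 := by
      intro k p h x hx i hi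
      rw [LieModule.lowerCentralSeries_succ, ← LieSubmodule.mem_toSubmodule,
        LieSubmodule.lieIdeal_oper_eq_linear_span'] at hx
      induction hx using Submodule.span_induction with
      | mem x hx =>
        obtain ⟨y, _, z, hz, rfl⟩ := hx
        exact h y z hz i hi
      | zero => simp
      | add x y _ _ hx hy => rw [map_add, Finsupp.add_apply, hx, hy, add_zero]
      | smul c x _ hx => rw [map_smul, Finsupp.smul_apply, hx, smul_zero]
    induction k generalizing x with
    | zero => exact hstep 0 2 (fun x y _ i hi => hb.repr_lie_lt_two x y i hi) x
    | succ k ih =>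
      refine hstep (k + 1) (k + 3) (fun x y hy i hi => ?_) x
      exact hb.repr_lie_eq_zero (p := 0) (fun _ h => absurd h (by omega)) (ih y hy) i (by omega)
  · intro hx
    have hmem : ∀ (k j : ℕ) (hj : j < n), k + 1 ≤ j →
        b ⟨j, hj⟩ ∈ LieModule.lowerCentralSeries F L L k := by
      intro k
      induction k with
      | zero => simp
      | succ k ih =>
        intro j hj hkj
        obtain ⟨j, rfl⟩ : ∃ i, j = i + 1 := ⟨j - 1, by omega⟩
        rw [← hb.lie_zero (by omega) hj, LieModule.lowerCentralSeries_succ]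
        exact LieSubmodule.lie_mem_lie (LieSubmodule.mem_top _) (ih j _ (by omega))
    rw [← b.sum_repr x]
    refine Submodule.sum_mem _ fun i _ => ?_
    by_cases hi : (i : ℕ) < k + 2
    · rw [hx i hi, zero_smul]
      exact Submodule.zero_mem _
    · exact Submodule.smul_mem _ _ (hmem (k + 1) i i.2 (by omega))

theorem isVergneType (hb : IsVergneBasis b) (hn : 2 ≤ n) : IsVergneType F L := by
  have hfin : Module.finrank F L = n := by simpa using Module.finrank_eq_card_basis b
  subst hfin
  refine ⟨⟨Module.Finite.of_basis b, ?_, b ⟨0, by omega⟩, ?_⟩, b, hb⟩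
  · have h : LieModule.lowerCentralSeries F L L (Module.finrank F L + 1) = ⊥ := by
      rw [eq_bot_iff]
      intro x hx
      rw [hb.mem_lowerCentralSeries] at hx
      rw [LieSubmodule.mem_bot, ← b.repr.map_eq_zero_iff]
      ext i
      exact hx i (by omega)
    exact LieModule.IsNilpotent.mk L h
  · have hpow : ∀ (k : ℕ) (hk : k + 1 < Module.finrank F L),
        ((LieAlgebra.ad F L (b ⟨0, by omega⟩)) ^ k) (b ⟨1, by omega⟩) = b ⟨k + 1, hk⟩ := by
      intro k
      induction k with
      | zero => intro _; rfl
      | succ k ih =>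
        intro hk
        rw [pow_succ', Module.End.mul_apply, ih (by omega), LieAlgebra.ad_apply,
          hb.lie_zero (by omega) hk]
    intro h
    have := hpow (Module.finrank F L - 2) (by omega)
    rw [h] at this
    exact b.ne_zero _ this.symm

/-- The structure constant `c₂,₃` vanishes if and only if the elements that move `γ₂` into `γ₄`
move it into `γ₅`; such elements are those without a component along `e₁`. -/
theorem centralizesDeeper_iff (hb : IsVergneBasis b) (hn : 5 ≤ n) :
    LieAlgebra.CentralizesDeeper F L ↔
      b.repr ⁅b ⟨1, by omega⟩, b ⟨2, by omega⟩⁆ ⟨4, by omega⟩ = 0 := by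
  have hlow : ∀ (j p : ℕ) (hj : j < n), p ≤ j → ∀ i : Fin n, (i : ℕ) < p →
      b.repr (b ⟨j, hj⟩) i = 0 := fun j p hj hp i hi => by
    rw [b.repr_self, Finsupp.single_apply, if_neg]
    intro h
    rw [← h] at hi
    simp only at hi
    omega
  constructor
  · intro h
    have hx := h (b ⟨1, by omega⟩) (fun y hy => ?_) (b ⟨2, by omega⟩) ?_
    · rw [hb.mem_lowerCentralSeries] at hx
      exact hx _ (by simp)
    · rw [hb.mem_lowerCentralSeries] at hy ⊢
      intro i hi
      exact hb.repr_lie_eq_zero (hlow 1 1 _ le_rfl) hy i (by omega)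
    · rw [hb.mem_lowerCentralSeries]
      exact hlow 2 2 _ le_rfl
  · intro hc x hx y hy
    have h02 : ⁅b ⟨0, by omega⟩, b ⟨2, by omega⟩⁆ = b ⟨3, by omega⟩ :=
      hb.lie_zero (j := 2) (by omega) (by omega)
    have hx0 : b.repr x ⟨0, by omega⟩ = 0 := by
      have h := hx (b ⟨2, by omega⟩)
        ((hb.mem_lowerCentralSeries 0 _).2 (hlow 2 2 _ le_rfl))
      rw [hb.mem_lowerCentralSeries] at h
      have h3 := h ⟨3, by omega⟩ (by simp)
      rw [repr_lie, Finset.sum_eq_single ⟨0, by omega⟩, Finset.sum_eq_single ⟨2, by omega⟩,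
        h02] at h3
      · simpa using h3
      · intro j _ hj
        simp [hj.symm]
      · simp
      · intro i _ hi
        refine Finset.sum_eq_zero fun j _ => ?_
        by_cases hj : j = ⟨2, by omega⟩
        · rw [hb.repr_lie_basis i j, mul_zero, mul_zero]
          have : (i : ℕ) ≠ 0 := fun h => hi (Fin.ext h)
          simp only [hj]
          omega
        · simp [Ne.symm hj]
      · simp
    rw [hb.mem_lowerCentralSeries] at hy ⊢
    intro k hk
    rw [repr_lie]
    refine Finset.sum_eq_zero fun i _ => Finset.sum_eq_zero fun j _ => ?_
    by_cases hi : (i : ℕ) = 0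
    · have : i = ⟨0, by omega⟩ := Fin.ext hi
      rw [this, hx0, zero_mul]
    by_cases hj : (j : ℕ) < 2
    · rw [hy j hj, zero_mul, mul_zero]
    by_cases hk' : (k : ℕ) = i + j + 1
    · have h1 : i = ⟨1, by omega⟩ := Fin.ext (by simp only; omega)
      have h2 : j = ⟨2, by omega⟩ := Fin.ext (by simp only; omega)
      have h3 : k = ⟨4, by omega⟩ := Fin.ext (by simp only; omega)
      rw [h1, h2, h3, hc, mul_zero, mul_zero]
    · rw [hb.repr_lie_basis i j k hk', mul_zero, mul_zero]

/-- The operator `ad(e₁)²` raises the index by two. -/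
theorem lie_zero_lie_zero (hb : IsVergneBasis b) {j : ℕ} (hj : 1 ≤ j) (hjn : j < n) :
    ⁅b ⟨0, by omega⟩, ⁅b ⟨0, by omega⟩, b ⟨j, hjn⟩⁆⁆ =
      if h : j + 2 < n then b ⟨j + 2, h⟩ else 0 := by
  have hlast : ∀ i : ℕ, ∀ hi : i < n, i + 1 = n → ⁅b ⟨0, by omega⟩, b ⟨i, hi⟩⁆ = 0 := by
    intro i hi h
    subst h
    exact hb.lie_one_last (by omega)
  split_ifs with h
  · rw [hb.lie_zero hj (by omega), hb.lie_zero (by omega) h]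
  · by_cases h1 : j + 1 < n
    · rw [hb.lie_zero hj h1, hlast _ _ (by omega)]
    · rw [hlast j hjn (by omega), _root_.lie_zero]

/-- The deformation along `t e₂*` and `ad(e₁)²` adds `t` to `c₂,ⱼ = -cⱼ,₂` for `j ≥ 3` and keeps
all other structure constants, so the basis remains a Vergne basis. -/
theorem map_deformation (hb : IsVergneBasis b) (hn : 2 ≤ n) (t : F) {L' : Type v} [LieRing L']
    [LieAlgebra F L'] (τ : L' ≃ₗ[F] L)
    (hτ : ∀ x y, τ ⁅x, y⁆ = ⁅τ x, τ y⁆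
      + (t • b.coord ⟨1, hn⟩) (τ x) • ⁅b ⟨0, by omega⟩, ⁅b ⟨0, by omega⟩, τ y⁆⁆
      - (t • b.coord ⟨1, hn⟩) (τ y) • ⁅b ⟨0, by omega⟩, ⁅b ⟨0, by omega⟩, τ x⁆⁆) :
    IsVergneBasis (b.map τ.symm) := by
  have hcoord : ∀ i (hi : i < n), i ≠ 1 → (t • b.coord ⟨1, hn⟩) (b ⟨i, hi⟩) = 0 := by
    intro i hi h
    simp [h]
  have h0 : ∀ j (hj : j < n), τ ⁅τ.symm (b ⟨0, by omega⟩), τ.symm (b ⟨j, hj⟩)⁆ =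
      ⁅b ⟨0, by omega⟩, b ⟨j, hj⟩⁆ := by
    intro j hj
    rw [hτ, LinearEquiv.apply_symm_apply, LinearEquiv.apply_symm_apply, hcoord 0 _ (by omega)]
    simp
  -- The deforming term is alternating, so it suffices to treat `i < j`.
  have hpos : ∀ i j (hi : 1 ≤ i) (hij : i < j) (hj : j < n), ∃ s : F,
      τ ⁅τ.symm (b ⟨i, by omega⟩), τ.symm (b ⟨j, hj⟩)⁆ = ⁅b ⟨i, by omega⟩, b ⟨j, hj⟩⁆
        + s • (if h : i + j + 1 < n then b ⟨i + j + 1, h⟩ else 0) := by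
    intro i j hi hij hj
    rw [hτ, LinearEquiv.apply_symm_apply, LinearEquiv.apply_symm_apply, hcoord j _ (by omega),
      zero_smul, sub_zero]
    by_cases h1 : i = 1
    · subst h1
      refine ⟨(t • b.coord ⟨1, hn⟩) (b ⟨1, by omega⟩), ?_⟩
      rw [hb.lie_zero_lie_zero (by omega) hj]
      have e : 1 + j + 1 = j + 2 := by omega
      simp only [e]
    · exact ⟨0, by rw [hcoord i _ h1, zero_smul, zero_smul]⟩
  have hall : ∀ i j (hi : 1 ≤ i) (hj : 1 ≤ j) (hin : i < n) (hjn : j < n), ∃ s : F,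
      τ ⁅τ.symm (b ⟨i, hin⟩), τ.symm (b ⟨j, hjn⟩)⁆ = ⁅b ⟨i, hin⟩, b ⟨j, hjn⟩⁆
        + s • (if h : i + j + 1 < n then b ⟨i + j + 1, h⟩ else 0) := by
    intro i j hi hj hin hjn
    rcases lt_trichotomy i j with h | h | h
    · exact hpos i j hi h hjn
    · subst h
      exact ⟨0, by simp⟩
    · obtain ⟨s, hs⟩ := hpos j i hj h hin
      refine ⟨-s, ?_⟩
      rw [← lie_skew, map_neg, hs, ← lie_skew (b ⟨j, hjn⟩)]
      simp only [add_comm j i]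
      module
  constructor
  · intro i hi hin
    apply τ.injective
    simp only [Module.Basis.map_apply, LinearEquiv.apply_symm_apply, h0]
    exact hb.lie_one i hi hin
  · intro h
    apply τ.injective
    simp only [Module.Basis.map_apply, h0, map_zero]
    exact hb.lie_one_last h
  · intro i j hi hj hij
    obtain ⟨c, hc⟩ := hb.lie_eq_smul i j hi hj hij
    obtain ⟨s, hs⟩ := hall (i - 1) (j - 1) (by omega) (by omega) (by omega) (by omega)
    refine ⟨c + s, τ.injective ?_⟩
    have e : i - 1 + (j - 1) + 1 = i + j - 1 := by omega
    simp only [e, dif_pos (show i + j - 1 < n by omega)] at hs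
    simp only [Module.Basis.map_apply, hs, hc, map_smul, LinearEquiv.apply_symm_apply,
      add_smul, map_add]
  · intro i j hi hj hin hjn hij
    obtain ⟨s, hs⟩ := hall (i - 1) (j - 1) (by omega) (by omega) (by omega) (by omega)
    apply τ.injective
    rw [dif_neg (by omega), hb.lie_eq_zero i j hi hj hin hjn hij] at hs
    simp only [Module.Basis.map_apply, hs, map_zero, smul_zero, add_zero]

end

end IsVergneBasis

/-! ### Algebras of Vergne type with equal Betti numbers -/

theorem theorem2 {F : Type u} [Field F] [CharP F 2]
    {L : Type v} [LieRing L] [LieAlgebra F L]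
    (hL : IsVergneType F L) (hdim : 5 ≤ Module.finrank F L) :
    ∃ (L' : Type v) (_ : LieRing L') (_ : LieAlgebra F L'),
      IsVergneType F L' ∧ IsEmpty (L ≃ₗ⁅F⁆ L') ∧
        ∀ k : ℕ, ChevalleyEilenberg.betti F L k = ChevalleyEilenberg.betti F L' k := by
  obtain ⟨-, b, hb⟩ := hL
  let e : L := b ⟨0, by omega⟩
  let D : L →ₗ[F] L := LieAlgebra.ad F L e
  let c : F := b.repr ⁅b ⟨1, by omega⟩, b ⟨2, by omega⟩⁆ ⟨4, by omega⟩
  -- The parameter is chosen so that exactly one of `c₂,₃ = c` and `c + t` is zero.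
  obtain ⟨t, ht⟩ : ∃ t : F, c + t = 0 ↔ c ≠ 0 := by
    by_cases h : c = 0
    · exact ⟨1, by simp [h]⟩
    · exact ⟨-c, by simp [h]⟩
  let φ : L →ₗ[F] F := t • b.coord ⟨1, by omega⟩
  have hφ : ∀ x y : L, φ ⁅x, y⁆ = 0 := fun x y => by
    simp [φ, hb.repr_lie_lt_two x y ⟨1, by omega⟩ (by simp)]
  have hφe : φ e = 0 := by simp [φ, e]
  -- The square of a derivation is a derivation in characteristic two.
  have hΔ : ∀ x y : L, (D ∘ₗ D) ⁅x, y⁆ = ⁅(D ∘ₗ D) x, y⁆ + ⁅x, (D ∘ₗ D) y⁆ := fun x y => by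
    have h2 : ⁅⁅e, x⁆, ⁅e, y⁆⁆ + ⁅⁅e, x⁆, ⁅e, y⁆⁆ = 0 := by
      rw [← two_smul F, CharTwo.two_eq_zero, zero_smul]
    simp only [D, LinearMap.comp_apply, LieAlgebra.ad_apply, leibniz_lie e x y, lie_add,
      leibniz_lie e ⁅e, x⁆ y, leibniz_lie e x ⁅e, y⁆]
    rw [add_assoc, ← add_assoc ⁅⁅e, x⁆, ⁅e, y⁆⁆, h2, zero_add]
  obtain ⟨L', _, _, τ, hτ⟩ := LieAlgebra.exists_deformation hφ (fun x => hφ e (D x)) hΔ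
  have hb' : IsVergneBasis (b.map τ.symm) := hb.map_deformation (by omega) t τ hτ
  refine ⟨L', _, _, hb'.isVergneType (by omega), ⟨fun f => ?_⟩,
    ChevalleyEilenberg.betti_deformation hφ hφe τ hτ⟩
  have hiff : LieAlgebra.CentralizesDeeper F L ↔ LieAlgebra.CentralizesDeeper F L' :=
    ⟨fun h => h.of_equiv f, fun h => h.of_equiv f.symm⟩
  have h4 : ⁅e, ⁅e, b ⟨2, by omega⟩⁆⁆ = b ⟨4, by omega⟩ := by
    rw [hb.lie_zero_lie_zero (by omega) (by omega), dif_pos (by omega)]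
  have hc' : (b.map τ.symm).repr ⁅b.map τ.symm ⟨1, by omega⟩, b.map τ.symm ⟨2, by omega⟩⁆
      ⟨4, by omega⟩ = c + t := by
    have hφ1 : φ (b ⟨1, by omega⟩) = t := by simp [φ]
    have hφ2 : φ (b ⟨2, by omega⟩) = 0 := by simp [φ]
    simp only [Module.Basis.map_repr, Module.Basis.map_apply, LinearEquiv.trans_apply,
      LinearEquiv.symm_symm, hτ, LinearEquiv.apply_symm_apply, hφ1, hφ2, zero_smul, sub_zero,
      LinearMap.comp_apply]
    simp only [D, LieAlgebra.ad_apply, h4]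
    simp [c]
  rw [hb.centralizesDeeper_iff hdim, hb'.centralizesDeeper_iff hdim, hc', ht] at hiff
  exact iff_not_self hiff
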